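/- Let $0<s_1<s_2<\cdots$ be real numbers and let $\pi_j\ge 0$ $(j\ge 1)$ with $\sum_{j\ge1}\pi_j=1$; let $\Pi$ be the discrete distribution with mass $\pi_j$ at $s_j$. Let $\xi\ge 1$ be an integer, let $G_m\sim\mathrm{Erlang}(\xi,\xi)$ (the gamma distribution with shape $\xi$ and rate $\xi$), and let $\Pi\star G_m$ be the Mellin--Stieltjes convolution, i.e. the distribution of the product of two independent random variables with distributions $\Pi$ and $G_m$. Let $0\le\rho<1$ (for instance $\rho=\gamma\mu_F<1$, with $\gamma$ the claim intensity and $\mu_F$ the mean claim size in a Cramér--Lundberg risk model). Consider a terminating renewal process with defective renewal distribution $\rho\,\Pi\star G_m$: its interarrival times $X_1,X_2,\dots$ are i.i.d. with values in $[0,\infty]$, with $\mathbb P(X_k\le x)=\rho\,(\Pi\star G_m)(x)$ for $0\le x<\infty$ and $\mathbb P(X_k=\infty)=1-\rho$. Its lifetime is $M=\sup\{S_n: n\ge 0,\ S_n<\infty\}$, where $S_n=X_1+\cdots+X_n$ and $S_0=0$. Write $\psi_{\Pi\star G_m}(u)=\mathbb P(M>u)$. Then for every $u\ge 0$ $$\psi_{\Pi\star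 G_m}(u)=\sum_{n=0}^{\infty}\kappa_n\,\frac{(\xi u/s_1)^n e^{-\xi u/s_1}}{n!},$$ where $$\kappa_n=\begin{cases}\rho, & 0\le n\le \xi-1,\\[4pt] \rho\Big[\sum_{i=\xi-1}^{n-1}\kappa_{n-1-i}\,\mathcal B_i+\mathcal C_n\Big], & n\ge \xi,\end{cases}$$ and $$\mathcal B_i=\sum_{j=1}^{\infty}\frac{\pi_j s_1}{s_j}\,\mathrm{bin}(\xi-1;i,s_1/s_j),\qquad \mathcal C_n=\sum_{j=1}^{\infty}\pi_j\,\mathrm{Bin}(\xi-1;n,s_1/s_j).$$ Here $\mathrm{bin}(\cdot;n,p)$ and $\mathrm{Bin}(\cdot;n,p)$ are the probability mass function and the cumulative distribution function of the binomial distribution with parameters $n$ and $p$, and all the series converge. -/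

import Mathlib

open MeasureTheory ProbabilityTheory
open scoped ENNReal

namespace ErlangizedScaleMixture

noncomputable section

/-- The discrete distribution on `ℝ` putting mass `w j` at the point `s j`. -/
def discreteLaw (s w : ℕ → ℝ) : Measure ℝ :=
  Measure.sum fun j => ENNReal.ofReal (w j) • Measure.dirac (s j)

/-- The Erlang distribution with shape `k` and rate `r`: the gamma distribution with integer shape. -/
def erlangLaw (k : ℕ) (r : ℝ) : Measure ℝ :=
  gammaMeasure (k : ℝ) r

/-- The Mellin-Stieltjes convolution `M ⋆ G` of two distributions on `[0, ∞)`: the law of the product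
of two independent random variables with laws `M` and `G`, i.e. Mathlib's multiplicative
convolution on the multiplicative monoid `ℝ`. -/
def mellinConv (M G : Measure ℝ) : Measure ℝ :=
  Measure.mconv M G

/-- The defective distribution `ρ H`, for `H` a distribution on `[0, ∞)`, completed to a probability
law on `[0, ∞]` by giving the missing mass `1 - ρ` to `∞`. -/
def defectiveLaw (ρ : ℝ) (H : Measure ℝ) : Measure ℝ≥0∞ :=
  ENNReal.ofReal ρ • H.map ENNReal.ofReal + ENNReal.ofReal (1 - ρ) • Measure.dirac ∞

/-- The `n`-th renewal epoch `X 0 + ⋯ + X (n - 1)` of the renewal process with interarrival times `X`;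
it is `∞` once some interarrival time is `∞`. -/
def renewalEpoch {Ω : Type*} (X : ℕ → Ω → ℝ≥0∞) (n : ℕ) (ω : Ω) : ℝ≥0∞ :=
  ∑ k ∈ Finset.range n, X k ω

/-- The lifetime of a terminating renewal process: the supremum of its finite renewal epochs. -/
def lifetime {Ω : Type*} (X : ℕ → Ω → ℝ≥0∞) (ω : Ω) : ℝ≥0∞ :=
  ⨆ (n : ℕ) (_ : renewalEpoch X n ω < ∞), renewalEpoch X n ω

/-- `X` is the sequence of interarrival times of a terminating renewal process with defective
renewal distribution `ρ H`: the `X n` are independent with common defective law `ρ H`. -/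
structure IsTerminatingRenewal {Ω : Type*} [MeasurableSpace Ω] (P : Measure Ω)
    (X : ℕ → Ω → ℝ≥0∞) (ρ : ℝ) (H : Measure ℝ) : Prop where
  indep : iIndepFun X P
  law : ∀ n, HasLaw (X n) (defectiveLaw ρ H) P

/-- The tail `ψ(u)` of the lifetime: the probability that it exceeds `u`. -/
def lifetimeTail {Ω : Type*} [MeasurableSpace Ω] (P : Measure Ω) (X : ℕ → Ω → ℝ≥0∞)
    (u : ℝ) : ℝ :=
  P.real {ω | ENNReal.ofReal u < lifetime X ω}

/-- The binomial probability mass function `bin(k; n, p)`. -/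
def binPMF (k n : ℕ) (p : ℝ) : ℝ :=
  (n.choose k : ℝ) * p ^ k * (1 - p) ^ (n - k)

/-- The binomial cumulative distribution function `Bin(k; n, p)`. -/
def binCDF (k n : ℕ) (p : ℝ) : ℝ :=
  ∑ i ∈ Finset.range (k + 1), binPMF i n p

/-- `binPMF` is the mass function of Mathlib's binomial distribution. -/
theorem binomial_real_singleton_eq (n k : ℕ) (p : unitInterval) :
    (ProbabilityTheory.binomial n p).real {k} = binPMF k n p :=
  binomial_real_singleton n k p

/-- The terms of the mixture `𝓑 i`; the smallest scale is `s 0`. -/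
def mixBTerm (s w : ℕ → ℝ) (ξ i j : ℕ) : ℝ :=
  w j * s 0 / s j * binPMF (ξ - 1) i (s 0 / s j)

/-- The terms of the mixture `𝓒 n`. -/
def mixCTerm (s w : ℕ → ℝ) (ξ n j : ℕ) : ℝ :=
  w j * binCDF (ξ - 1) n (s 0 / s j)

/-- `𝓑 i = ∑ⱼ (πⱼ s₁ / sⱼ) bin(ξ - 1; i, s₁ / sⱼ)`. -/
def mixB (s w : ℕ → ℝ) (ξ i : ℕ) : ℝ := ∑' j, mixBTerm s w ξ i j

/-- `𝓒 n = ∑ⱼ πⱼ Bin(ξ - 1; n, s₁ / sⱼ)`. -/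
def mixC (s w : ℕ → ℝ) (ξ n : ℕ) : ℝ := ∑' j, mixCTerm s w ξ n j

/-- The coefficients `κ n`, for `1 ≤ ξ`: `κ n = ρ` for `n ≤ ξ - 1`, and for `n ≥ ξ`
`κ n = ρ (∑ i ∈ [ξ - 1, n - 1], κ (n - 1 - i) 𝓑 i + 𝓒 n)`; see `kappa_of_le` and `kappa_of_ge`. -/
def kappa (ρ : ℝ) (s w : ℕ → ℝ) (ξ : ℕ) (n : ℕ) : ℝ :=
  if n ≤ ξ - 1 then ρ
  else ρ * (∑ i ∈ Finset.Icc (ξ - 1) (n - 1), kappa ρ s w ξ (n - 1 - i) * mixB s w ξ i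
    + mixC s w ξ n)
termination_by n
decreasing_by omega

theorem kappa_of_le (ρ : ℝ) (s w : ℕ → ℝ) (ξ n : ℕ) (hn : n ≤ ξ - 1) :
    kappa ρ s w ξ n = ρ := by
  rw [kappa, if_pos hn]

theorem kappa_of_ge (ρ : ℝ) (s w : ℕ → ℝ) (ξ n : ℕ) (hξ : 1 ≤ ξ) (hn : ξ ≤ n) :
    kappa ρ s w ξ n = ρ * (∑ i ∈ Finset.Icc (ξ - 1) (n - 1),
      kappa ρ s w ξ (n - 1 - i) * mixB s w ξ i + mixC s w ξ n) := by
  rw [kappa, if_neg (by omega)]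

end

end ErlangizedScaleMixture

/-! The argument expands everything in the Poisson weights `t ^ n * exp (-t) / n!` evaluated at
`t = r * u`, where `r = ξ / s 0` is the largest rate among the Erlang components of the mixture.

Poisson thinning (`hasSum_poissonWeight_mul_binPMF`) rewrites an Erlang component of rate `p * r`,
`0 < p ≤ 1`, in weights of rate `r` with binomial coefficients. Summed over the components, this
gives the density of the interarrival law the coefficients `mixB` (`mixtureDensity_eq_tsum`) and its
tail the coefficients `mixC` (`lintegral_Ioi_mixtureDensity`). Convolving the weight of index `k`
with the Erlang density of shape `i + 1` produces the weight of index `k + i + 1`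
(`lintegral_Ioc_poissonWeight_mul`, a Beta integral), so a renewal step acts on coefficients by a
shifted Cauchy product.

The event that the lifetime exceeds `u` is the disjoint union over `n` of the events
`S n ≤ u < S (n + 1) < ∞`, with `S` the renewal epochs (`setOf_lt_lifetime`). Conditioning on one
interarrival time, the probability of the `n`-th event has coefficients that follow a linear
recursion in `n` (`lintegral_jumpOver_epochLaw`), and their sum over `n` satisfies the defining recursion of `kappa`
(`tsum_crossingCoeff`). All terms are nonnegative, so the sums and integrals are interchanged in
`ℝ≥0∞` without any convergence condition, and the convergence of the final real series follows from
the sum being a probability. -/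

namespace ErlangizedScaleMixture

/-! ### Poisson weights, thinning and Erlang integrals -/

/-- The Poisson weight `t ^ n * exp (-t) / n!`, as a function of the real parameter `t`. -/
noncomputable def poissonWeight (n : ℕ) (t : ℝ) : ℝ :=
  t ^ n * Real.exp (-t) / (n.factorial : ℝ)

theorem poissonWeight_nonneg (n : ℕ) {t : ℝ} (ht : 0 ≤ t) : 0 ≤ poissonWeight n t := by
  unfold poissonWeight; positivity

@[fun_prop]
theorem continuous_poissonWeight (n : ℕ) : Continuous (poissonWeight n) := by
  unfold poissonWeight; fun_prop

@[fun_prop]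
theorem measurable_poissonWeight (n : ℕ) : Measurable (poissonWeight n) :=
  (continuous_poissonWeight n).measurable

theorem binPMF_nonneg (k n : ℕ) {p : ℝ} (h0 : 0 ≤ p) (h1 : p ≤ 1) : 0 ≤ binPMF k n p := by
  have : 0 ≤ 1 - p := by linarith
  unfold binPMF; positivity

theorem binPMF_of_lt {k n : ℕ} (h : n < k) (p : ℝ) : binPMF k n p = 0 := by
  simp [binPMF, Nat.choose_eq_zero_of_lt h]

theorem binCDF_nonneg (k n : ℕ) {p : ℝ} (h0 : 0 ≤ p) (h1 : p ≤ 1) : 0 ≤ binCDF k n p :=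
  Finset.sum_nonneg fun _ _ => binPMF_nonneg _ _ h0 h1

theorem binPMF_le_choose (k n : ℕ) {p : ℝ} (h0 : 0 ≤ p) (h1 : p ≤ 1) :
    binPMF k n p ≤ n.choose k := by
  unfold binPMF
  have h2 : p ^ k ≤ 1 := pow_le_one₀ h0 h1
  have h3 : (1 - p) ^ (n - k) ≤ 1 := pow_le_one₀ (by linarith) (by linarith)
  have h4 : (0 : ℝ) ≤ n.choose k := by positivity
  calc _ ≤ (n.choose k : ℝ) * 1 * 1 := by
        gcongr
    _ = _ := by ring

theorem binCDF_of_le {k n : ℕ} (h : n ≤ k) (p : ℝ) : binCDF k n p = 1 := by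
  have h1 : ∑ i ∈ Finset.range (n + 1), binPMF i n p = 1 := by
    have := add_pow p (1 - p) n
    rw [add_sub_cancel, one_pow] at this
    rw [this]
    exact Finset.sum_congr rfl fun i _ => by unfold binPMF; ring
  rw [binCDF, ← h1]
  symm
  refine Finset.sum_subset (Finset.range_mono (by omega)) fun i _ hi => ?_
  exact binPMF_of_lt (by simpa using hi) p

/-- Poisson thinning: keeping each of a Poisson number of points with probability `p` leaves a
Poisson number of points. -/
theorem hasSum_poissonWeight_mul_binPMF (k : ℕ) (t p : ℝ) :
    HasSum (fun n => poissonWeight n t * binPMF k n p) (poissonWeight k (p * t)) := by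
  have h0 : ∀ n ∉ Set.range (fun m : ℕ => m + k), poissonWeight n t * binPMF k n p = 0 := by
    intro n hn
    rw [binPMF_of_lt, mul_zero]
    by_contra! h
    exact hn ⟨n - k, by simp; omega⟩
  rw [← (add_left_injective k).hasSum_iff h0]
  have h1 : HasSum (fun m : ℕ => ((1 - p) * t) ^ m / (m.factorial : ℝ))
      (Real.exp ((1 - p) * t)) := by
    rw [Real.exp_eq_exp_ℝ]
    exact NormedSpace.expSeries_div_hasSum_exp _
  have h5 : poissonWeight k (p * t)
      = (p * t) ^ k * Real.exp (-t) / k.factorial * Real.exp ((1 - p) * t) := by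
    have : -(p * t) = -t + (1 - p) * t := by ring
    rw [poissonWeight, this, Real.exp_add]; ring
  have h6 : (fun n => poissonWeight n t * binPMF k n p) ∘ (fun m : ℕ => m + k)
      = fun m : ℕ => (p * t) ^ k * Real.exp (-t) / k.factorial *
        (((1 - p) * t) ^ m / (m.factorial : ℝ)) := by
    ext m
    have h2 := Nat.add_choose_mul_factorial_mul_factorial m k
    have h3 : ((m + k).choose k : ℝ) * m.factorial * k.factorial = (m + k).factorial := by
      exact_mod_cast h2
    have h4 : ((m + k).factorial : ℝ) ≠ 0 := by positivity
    simp only [Function.comp, poissonWeight, binPMF, Nat.add_sub_cancel, mul_pow]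
    rw [← h3] at h4 ⊢
    have : ((m + k).choose k : ℝ) ≠ 0 := fun h => h4 (by simp [h])
    field_simp
    ring
  rw [h5, h6]
  exact h1.mul_left _

theorem tsum_ofReal_poissonWeight_mul_binPMF (k : ℕ) {t p : ℝ} (ht : 0 ≤ t) (h0 : 0 ≤ p)
    (h1 : p ≤ 1) :
    ∑' n, ENNReal.ofReal (poissonWeight n t) * ENNReal.ofReal (binPMF k n p)
      = ENNReal.ofReal (poissonWeight k (p * t)) := by
  have h := hasSum_poissonWeight_mul_binPMF k t p
  rw [← h.tsum_eq, ENNReal.ofReal_tsum_of_nonneg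
    (fun n => mul_nonneg (poissonWeight_nonneg n ht) (binPMF_nonneg k n h0 h1)) h.summable]
  exact tsum_congr fun n => (ENNReal.ofReal_mul (poissonWeight_nonneg n ht)).symm

theorem tsum_ofReal_poissonWeight_mul_binCDF (k : ℕ) {t p : ℝ} (ht : 0 ≤ t) (h0 : 0 ≤ p)
    (h1 : p ≤ 1) :
    ∑' n, ENNReal.ofReal (poissonWeight n t) * ENNReal.ofReal (binCDF k n p)
      = ∑ i ∈ Finset.range (k + 1), ENNReal.ofReal (poissonWeight i (p * t)) := by
  simp_rw [binCDF, ENNReal.ofReal_sum_of_nonneg fun i _ => binPMF_nonneg i _ h0 h1,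
    Finset.mul_sum]
  rw [Summable.tsum_finsetSum fun _ _ => ENNReal.summable]
  exact Finset.sum_congr rfl fun i _ => tsum_ofReal_poissonWeight_mul_binPMF i ht h0 h1

theorem hasDerivAt_sum_poissonWeight (k : ℕ) (t : ℝ) :
    HasDerivAt (fun t => ∑ i ∈ Finset.range (k + 1), poissonWeight i t)
      (-poissonWeight k t) t := by
  induction k with
  | zero =>
    simpa [poissonWeight] using (hasDerivAt_id t).neg.exp
  | succ k ih =>
    simp_rw [Finset.sum_range_succ _ (k + 1)]
    have h : HasDerivAt (poissonWeight (k + 1))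
        (poissonWeight k t - poissonWeight (k + 1) t) t := by
      have := (((hasDerivAt_id t).pow (k + 1)).mul (hasDerivAt_id t).neg.exp).div_const
        ((k + 1).factorial : ℝ)
      refine this.congr_deriv ?_
      simp only [poissonWeight, Nat.factorial_succ, id, Nat.cast_mul, Pi.pow_apply, Pi.neg_apply]
      have : (k.factorial : ℝ) ≠ 0 := by positivity
      push_cast
      field_simp
      ring
    exact (ih.add h).congr_deriv (by ring)

theorem tendsto_poissonWeight_atTop (n : ℕ) :
    Filter.Tendsto (poissonWeight n) Filter.atTop (nhds 0) := by
  have := (Real.tendsto_pow_mul_exp_neg_atTop_nhds_zero n).div_const (n.factorial : ℝ)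
  rwa [zero_div] at this

/-- The tail of the Erlang distribution of shape `k + 1` and rate `r`. -/
theorem lintegral_Ioi_poissonWeight (k : ℕ) {r v : ℝ} (hr : 0 < r) (hv : 0 ≤ v) :
    ∫⁻ y in Set.Ioi v, ENNReal.ofReal (r * poissonWeight k (r * y))
      = ∑ i ∈ Finset.range (k + 1), ENNReal.ofReal (poissonWeight i (r * v)) := by
  have hd : ∀ y ∈ Set.Ici v, HasDerivAt
      (fun y => -∑ i ∈ Finset.range (k + 1), poissonWeight i (r * y))
      (r * poissonWeight k (r * y)) y := by
    intro y _
    have h1 : HasDerivAt (fun y : ℝ => r * y) r y := by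
      simpa using (hasDerivAt_id y).const_mul r
    refine ((hasDerivAt_sum_poissonWeight k (r * y)).comp y h1).neg.congr_deriv ?_
    ring
  have hn : ∀ y ∈ Set.Ioi v, 0 ≤ r * poissonWeight k (r * y) := fun y hy =>
    mul_nonneg hr.le (poissonWeight_nonneg _ (mul_nonneg hr.le (hv.trans (le_of_lt hy))))
  have hl : Filter.Tendsto (fun y => -∑ i ∈ Finset.range (k + 1), poissonWeight i (r * y))
      Filter.atTop (nhds 0) := by
    have : Filter.Tendsto (fun y => -∑ i ∈ Finset.range (k + 1), poissonWeight i (r * y))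
        Filter.atTop (nhds (-∑ i ∈ Finset.range (k + 1), (0 : ℝ))) :=
      (tendsto_finsetSum _ fun i _ => (tendsto_poissonWeight_atTop i).comp
        (Filter.tendsto_id.const_mul_atTop hr)).neg
    simpa using this
  rw [← ofReal_integral_eq_lintegral_ofReal (integrableOn_Ioi_deriv_of_nonneg' hd hn hl)
    ((ae_restrict_iff' measurableSet_Ioi).2 (Filter.Eventually.of_forall hn)),
    integral_Ioi_of_hasDerivAt_of_nonneg' hd hn hl, zero_sub, neg_neg,
    ENNReal.ofReal_sum_of_nonneg fun i _ => poissonWeight_nonneg _ (mul_nonneg hr.le hv)]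

/-- The Beta integral at positive integers, normalized by factorials. -/
theorem integral_sub_pow_mul_pow (k i : ℕ) (u : ℝ) :
    ∫ y in (0 : ℝ)..u, (u - y) ^ k / (k.factorial : ℝ) * (y ^ i / (i.factorial : ℝ))
      = u ^ (k + i + 1) / ((k + i + 1).factorial : ℝ) := by
  induction k generalizing i with
  | zero =>
    simp only [pow_zero, Nat.factorial_zero, Nat.cast_one, div_one, one_mul, zero_add]
    rw [intervalIntegral.integral_div, integral_pow, Nat.factorial_succ]
    have : (i.factorial : ℝ) ≠ 0 := by positivity
    push_cast
    field_simp
    simp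
  | succ k ih =>
    -- integration by parts: the product of the two shifted powers vanishes at both ends
    have hd : ∀ y : ℝ, HasDerivAt (fun y => (u - y) ^ (k + 1) / ((k + 1).factorial : ℝ) *
        (y ^ (i + 1) / ((i + 1).factorial : ℝ)))
        ((u - y) ^ (k + 1) / ((k + 1).factorial : ℝ) * (y ^ i / (i.factorial : ℝ)) -
          (u - y) ^ k / (k.factorial : ℝ) * (y ^ (i + 1) / ((i + 1).factorial : ℝ))) y := by
      intro y
      have h1 := (((hasDerivAt_id y).const_sub u).pow (k + 1)).div_const ((k + 1).factorial : ℝ)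
      have h2 := ((hasDerivAt_id y).pow (i + 1)).div_const ((i + 1).factorial : ℝ)
      refine (h1.mul h2).congr_deriv ?_
      have : (k.factorial : ℝ) ≠ 0 := by positivity
      have : (i.factorial : ℝ) ≠ 0 := by positivity
      simp only [Nat.factorial_succ, id, Pi.pow_apply]
      push_cast
      field_simp
      ring
    have h := intervalIntegral.integral_eq_sub_of_hasDerivAt (fun y _ => hd y)
      (Continuous.intervalIntegrable (by fun_prop) 0 u)
    rw [intervalIntegral.integral_sub (Continuous.intervalIntegrable (by fun_prop) 0 u)
      (Continuous.intervalIntegrable (by fun_prop) 0 u), ih (i + 1)] at h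
    simp only [sub_self, ne_eq, Nat.add_eq_zero_iff, one_ne_zero, and_false, not_false_eq_true,
      zero_pow, zero_div, zero_mul, mul_zero] at h
    rw [sub_eq_zero.1 h]
    congr 2 <;> ring_nf

/-- Convolving a Poisson weight of index `k` with the Erlang density of shape `i + 1` gives the
Poisson weight of index `k + i + 1`. -/
theorem lintegral_Ioc_poissonWeight_mul (k i : ℕ) {r u : ℝ} (hr : 0 < r) (hu : 0 ≤ u) :
    ∫⁻ y in Set.Ioc 0 u, ENNReal.ofReal (poissonWeight k (r * (u - y))) *
        ENNReal.ofReal (r * poissonWeight i (r * y))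
      = ENNReal.ofReal (poissonWeight (k + i + 1) (r * u)) := by
  have h1 : ∀ y ∈ Set.Ioc 0 u, ENNReal.ofReal (poissonWeight k (r * (u - y))) *
        ENNReal.ofReal (r * poissonWeight i (r * y)) =
      ENNReal.ofReal (r ^ (k + i + 1) * Real.exp (-(r * u)) *
        ((u - y) ^ k / (k.factorial : ℝ) * (y ^ i / (i.factorial : ℝ)))) := by
    intro y hy
    rw [← ENNReal.ofReal_mul (poissonWeight_nonneg _ (mul_nonneg hr.le (by linarith [hy.2])))]
    congr 1
    have : -(r * u) = -(r * (u - y)) + -(r * y) := by ring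
    rw [this, Real.exp_add, poissonWeight, poissonWeight, mul_pow, mul_pow]
    ring
  rw [setLIntegral_congr_fun measurableSet_Ioc h1, ← ofReal_integral_eq_lintegral_ofReal]
  · rw [← intervalIntegral.integral_of_le hu, intervalIntegral.integral_const_mul,
      integral_sub_pow_mul_pow, poissonWeight, mul_pow]
    congr 1; ring
  · exact (Continuous.integrableOn_Icc (by fun_prop)).mono_set Set.Ioc_subset_Icc_self
  · refine (ae_restrict_iff' measurableSet_Ioc).2 (Filter.Eventually.of_forall fun y hy => ?_)
    have h2 : 0 ≤ u - y := by linarith [hy.2]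
    have h3 : 0 ≤ y := hy.1.le
    simp only [Pi.zero_apply]
    positivity

/-! ### The interarrival law -/

/-- Scaling the Erlang distribution of shape `m + 1` and rate `r` by `c` gives the Erlang
distribution of rate `r / c`. -/
theorem lintegral_comp_mul_gammaMeasure (m : ℕ) (r : ℝ) {c : ℝ} (hc : 0 < c)
    {φ : ℝ → ℝ≥0∞} (hφ : Measurable φ) :
    ∫⁻ x, φ (c * x) ∂(gammaMeasure ((m + 1 : ℕ) : ℝ) r)
      = ∫⁻ y in Set.Ioi 0, φ y * ENNReal.ofReal (r / c * poissonWeight m (r / c * y)) := by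
  have hpdf : Measurable (gammaPDF ((m + 1 : ℕ) : ℝ) r) :=
    (measurable_gammaPDFReal _ _).ennreal_ofReal
  have h1 : ∫⁻ x, φ (c * x) ∂(gammaMeasure ((m + 1 : ℕ) : ℝ) r)
      = ∫⁻ x, gammaPDF ((m + 1 : ℕ) : ℝ) r x * φ (c * x) := by
    rw [gammaMeasure, lintegral_withDensity_eq_lintegral_mul _ hpdf (by fun_prop)]
    rfl
  have h2 : ∫⁻ x, gammaPDF ((m + 1 : ℕ) : ℝ) r x * φ (c * x)
      = ∫⁻ y, gammaPDF ((m + 1 : ℕ) : ℝ) r (y / c) * φ y ∂(volume.map (c * ·)) := by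
    rw [lintegral_map (by fun_prop) (by fun_prop)]
    exact lintegral_congr fun x => by rw [mul_div_cancel_left₀ _ hc.ne']
  rw [h1, h2, Real.map_volume_mul_left hc.ne', lintegral_smul_measure,
    abs_of_pos (inv_pos.2 hc), smul_eq_mul, ← lintegral_const_mul _ (by fun_prop),
    ← lintegral_indicator measurableSet_Ioi]
  refine lintegral_congr_ae ?_
  -- the point `0` is excluded: there the two densities may differ
  have h0 : ∀ᵐ y : ℝ, y ≠ 0 := by simp [ae_iff]
  filter_upwards [h0] with y hy
  rcases lt_or_gt_of_ne hy with h | h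
  · rw [Set.indicator_of_notMem (by simpa using h.le),
      gammaPDF_of_neg (div_neg_of_neg_of_pos h hc), zero_mul, mul_zero]
  · rw [Set.indicator_of_mem (by simpa using h), gammaPDF_of_nonneg (div_pos h hc).le,
      ← mul_assoc, ← ENNReal.ofReal_mul (inv_pos.2 hc).le, mul_comm]
    congr 2
    have h4 : ((m + 1 : ℕ) : ℝ) - 1 = m := by push_cast; ring
    rw [h4, Nat.cast_succ, Real.Gamma_nat_eq_factorial, ← Nat.cast_succ, Real.rpow_natCast,
      Real.rpow_natCast, poissonWeight]
    have h5 : r / c * y = r * (y / c) := by ring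
    rw [h5, mul_pow, pow_succ]
    ring

/-- The density of `Π ⋆ Erlang(m + 1, s 0 * r)` on `(0, ∞)`, where `Π` has mass `w j` at `s j`: the
mixture of the Erlang densities of shape `m + 1` and rates `(s 0 / s j) * r`. -/
noncomputable def mixtureDensity (s w : ℕ → ℝ) (m : ℕ) (r y : ℝ) : ℝ≥0∞ :=
  ∑' j, ENNReal.ofReal (w j) *
    ENNReal.ofReal (s 0 / s j * r * poissonWeight m (s 0 / s j * r * y))

theorem lintegral_mellinConv (s w : ℕ → ℝ) (hs : ∀ j, 0 < s j) (m : ℕ) {a : ℝ} (ha : 0 < a)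
    {φ : ℝ → ℝ≥0∞} (hφ : Measurable φ) :
    ∫⁻ z, φ z ∂(mellinConv (discreteLaw s w) (erlangLaw (m + 1) a))
      = ∫⁻ y in Set.Ioi 0, φ y * mixtureDensity s w m (a / s 0) y := by
  have hG : IsProbabilityMeasure (gammaMeasure ((m + 1 : ℕ) : ℝ) a) :=
    isProbabilityMeasure_gammaMeasure (by positivity) ha
  have hmeas : Measurable fun x : ℝ =>
      ∫⁻ y, φ (x * y) ∂(gammaMeasure ((m + 1 : ℕ) : ℝ) a) :=
    Measurable.lintegral_prod_right' (f := fun p : ℝ × ℝ => φ (p.1 * p.2)) (by fun_prop)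
  rw [mellinConv, erlangLaw, Measure.lintegral_mconv hφ, discreteLaw, lintegral_sum_measure]
  simp_rw [lintegral_smul_measure, lintegral_dirac' _ hmeas,
    lintegral_comp_mul_gammaMeasure m a (hs _) hφ, mixtureDensity, ← ENNReal.tsum_mul_left]
  rw [lintegral_tsum fun j => by fun_prop]
  refine tsum_congr fun j => ?_
  rw [smul_eq_mul, ← lintegral_const_mul _ (by fun_prop)]
  refine lintegral_congr fun y => ?_
  have : s 0 / s j * (a / s 0) = a / s j := by
    have := (hs 0).ne'; have := (hs j).ne'; field_simp
  rw [this, mul_left_comm]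

/-- Integration against the defective interarrival law of a function that does not see the atom
at `∞`. -/
theorem lintegral_defectiveLaw (s w : ℕ → ℝ) (hs : ∀ j, 0 < s j) (m : ℕ) {a : ℝ} (ha : 0 < a)
    (ρ : ℝ) {φ : ℝ≥0∞ → ℝ≥0∞} (hφ : Measurable φ) (hφ_top : φ ∞ = 0) :
    ∫⁻ z, φ z ∂(defectiveLaw ρ (mellinConv (discreteLaw s w) (erlangLaw (m + 1) a)))
      = ENNReal.ofReal ρ *
        ∫⁻ y in Set.Ioi 0, φ (ENNReal.ofReal y) * mixtureDensity s w m (a / s 0) y := by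
  rw [defectiveLaw, lintegral_add_measure, lintegral_smul_measure, lintegral_smul_measure,
    lintegral_dirac' _ hφ, hφ_top, smul_zero, add_zero, lintegral_map hφ (by fun_prop),
    lintegral_mellinConv s w hs m ha (by fun_prop), smul_eq_mul]

/-! ### Expansion of the interarrival law in Poisson weights -/

section Coefficients

variable {s w : ℕ → ℝ}

theorem scale_ratio_nonneg (hs_pos : 0 < s 0) (hs_mono : StrictMono s) (j : ℕ) :
    0 ≤ s 0 / s j :=
  div_nonneg hs_pos.le (hs_pos.le.trans (hs_mono.monotone (Nat.zero_le j)))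

theorem scale_ratio_le_one (hs_pos : 0 < s 0) (hs_mono : StrictMono s) (j : ℕ) :
    s 0 / s j ≤ 1 :=
  div_le_one_of_le₀ (hs_mono.monotone (Nat.zero_le j))
    (hs_pos.le.trans (hs_mono.monotone (Nat.zero_le j)))

theorem mixBTerm_eq (s w : ℕ → ℝ) (ξ i j : ℕ) :
    mixBTerm s w ξ i j = w j * (s 0 / s j * binPMF (ξ - 1) i (s 0 / s j)) := by
  unfold mixBTerm; ring

theorem mixBTerm_nonneg (hs_pos : 0 < s 0) (hs_mono : StrictMono s) (hw : ∀ j, 0 ≤ w j)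
    (ξ i j : ℕ) : 0 ≤ mixBTerm s w ξ i j := by
  have h0 := scale_ratio_nonneg hs_pos hs_mono j
  rw [mixBTerm_eq]
  exact mul_nonneg (hw j) (mul_nonneg h0
    (binPMF_nonneg _ _ h0 (scale_ratio_le_one hs_pos hs_mono j)))

theorem mixCTerm_nonneg (hs_pos : 0 < s 0) (hs_mono : StrictMono s) (hw : ∀ j, 0 ≤ w j)
    (ξ n j : ℕ) : 0 ≤ mixCTerm s w ξ n j :=
  mul_nonneg (hw j) (binCDF_nonneg _ _ (scale_ratio_nonneg hs_pos hs_mono j)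
    (scale_ratio_le_one hs_pos hs_mono j))

theorem summable_mixBTerm (hs_pos : 0 < s 0) (hs_mono : StrictMono s) (hw : ∀ j, 0 ≤ w j)
    (hw_sum : Summable w) (ξ i : ℕ) : Summable (mixBTerm s w ξ i) := by
  refine Summable.of_nonneg_of_le (mixBTerm_nonneg hs_pos hs_mono hw ξ i) (fun j => ?_)
    (hw_sum.mul_right (i.choose (ξ - 1) : ℝ))
  have h0 := scale_ratio_nonneg hs_pos hs_mono j
  have h1 := scale_ratio_le_one hs_pos hs_mono j
  rw [mixBTerm_eq]
  exact mul_le_mul_of_nonneg_left ((mul_le_of_le_one_left (binPMF_nonneg _ _ h0 h1) h1).trans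
    (binPMF_le_choose _ _ h0 h1)) (hw j)

theorem summable_mixCTerm (hs_pos : 0 < s 0) (hs_mono : StrictMono s) (hw : ∀ j, 0 ≤ w j)
    (hw_sum : Summable w) (ξ n : ℕ) : Summable (mixCTerm s w ξ n) := by
  refine Summable.of_nonneg_of_le (mixCTerm_nonneg hs_pos hs_mono hw ξ n) (fun j => ?_)
    (hw_sum.mul_right (∑ i ∈ Finset.range (ξ - 1 + 1), (n.choose i : ℝ)))
  exact mul_le_mul_of_nonneg_left (Finset.sum_le_sum fun i _ => binPMF_le_choose _ _
    (scale_ratio_nonneg hs_pos hs_mono j) (scale_ratio_le_one hs_pos hs_mono j)) (hw j)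

theorem mixB_nonneg (hs_pos : 0 < s 0) (hs_mono : StrictMono s) (hw : ∀ j, 0 ≤ w j)
    (ξ i : ℕ) : 0 ≤ mixB s w ξ i :=
  tsum_nonneg (mixBTerm_nonneg hs_pos hs_mono hw ξ i)

theorem mixC_nonneg (hs_pos : 0 < s 0) (hs_mono : StrictMono s) (hw : ∀ j, 0 ≤ w j)
    (ξ n : ℕ) : 0 ≤ mixC s w ξ n :=
  tsum_nonneg (mixCTerm_nonneg hs_pos hs_mono hw ξ n)

theorem mixB_of_lt (s w : ℕ → ℝ) {ξ i : ℕ} (h : i < ξ - 1) : mixB s w ξ i = 0 := by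
  simp [mixB, mixBTerm, binPMF_of_lt h]

theorem mixC_of_le (hw_sum : HasSum w 1) {ξ n : ℕ} (h : n ≤ ξ - 1) : mixC s w ξ n = 1 := by
  simp [mixC, mixCTerm, binCDF_of_le h, hw_sum.tsum_eq]

theorem ofReal_mixB (hs_pos : 0 < s 0) (hs_mono : StrictMono s) (hw : ∀ j, 0 ≤ w j)
    (hw_sum : Summable w) (ξ i : ℕ) :
    ENNReal.ofReal (mixB s w ξ i) = ∑' j, ENNReal.ofReal (w j) *
      (ENNReal.ofReal (s 0 / s j) * ENNReal.ofReal (binPMF (ξ - 1) i (s 0 / s j))) := by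
  rw [mixB, ENNReal.ofReal_tsum_of_nonneg (mixBTerm_nonneg hs_pos hs_mono hw ξ i)
    (summable_mixBTerm hs_pos hs_mono hw hw_sum ξ i)]
  refine tsum_congr fun j => ?_
  rw [mixBTerm_eq, ENNReal.ofReal_mul (hw j),
    ENNReal.ofReal_mul (scale_ratio_nonneg hs_pos hs_mono j)]

theorem ofReal_mixC (hs_pos : 0 < s 0) (hs_mono : StrictMono s) (hw : ∀ j, 0 ≤ w j)
    (hw_sum : Summable w) (ξ n : ℕ) :
    ENNReal.ofReal (mixC s w ξ n) = ∑' j, ENNReal.ofReal (w j) *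
      ENNReal.ofReal (binCDF (ξ - 1) n (s 0 / s j)) := by
  rw [mixC, ENNReal.ofReal_tsum_of_nonneg (mixCTerm_nonneg hs_pos hs_mono hw ξ n)
    (summable_mixCTerm hs_pos hs_mono hw hw_sum ξ n)]
  exact tsum_congr fun j => ENNReal.ofReal_mul (hw j)

/-- Thinning every component down from the largest rate `r` expands the mixture density in the
Erlang densities of rate `r`, with coefficients `mixB`. -/
theorem mixtureDensity_eq_tsum (hs_pos : 0 < s 0) (hs_mono : StrictMono s)
    (hw : ∀ j, 0 ≤ w j) (hw_sum : Summable w) (m : ℕ) {r y : ℝ} (hr : 0 < r) (hy : 0 ≤ y) :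
    mixtureDensity s w m r y = ∑' i, ENNReal.ofReal (mixB s w (m + 1) i) *
      ENNReal.ofReal (r * poissonWeight i (r * y)) := by
  simp_rw [ofReal_mixB hs_pos hs_mono hw hw_sum, ← ENNReal.tsum_mul_right]
  rw [ENNReal.tsum_comm, mixtureDensity]
  refine tsum_congr fun j => ?_
  have h0 := scale_ratio_nonneg hs_pos hs_mono j
  have h1 := scale_ratio_le_one hs_pos hs_mono j
  rw [mul_assoc (s 0 / s j) r y, ENNReal.ofReal_mul (mul_nonneg h0 hr.le),
    ← tsum_ofReal_poissonWeight_mul_binPMF m (mul_nonneg hr.le hy) h0 h1,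
    ENNReal.ofReal_mul h0, ← ENNReal.tsum_mul_left, ← ENNReal.tsum_mul_left]
  refine tsum_congr fun i => ?_
  rw [ENNReal.ofReal_mul hr.le, Nat.add_sub_cancel]
  ring

/-- The tail of the mixture, expanded in Poisson weights with coefficients `mixC`. -/
theorem lintegral_Ioi_mixtureDensity (hs_pos : 0 < s 0) (hs_mono : StrictMono s)
    (hw : ∀ j, 0 ≤ w j) (hw_sum : Summable w) (m : ℕ) {r v : ℝ} (hr : 0 < r) (hv : 0 ≤ v) :
    ∫⁻ y in Set.Ioi v, mixtureDensity s w m r y = ∑' n, ENNReal.ofReal (mixC s w (m + 1) n) *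
      ENNReal.ofReal (poissonWeight n (r * v)) := by
  simp_rw [ofReal_mixC hs_pos hs_mono hw hw_sum, ← ENNReal.tsum_mul_right]
  rw [ENNReal.tsum_comm]
  simp_rw [mixtureDensity]
  rw [lintegral_tsum fun j => by fun_prop]
  refine tsum_congr fun j => ?_
  have hp : 0 < s 0 / s j :=
    div_pos hs_pos (hs_pos.trans_le (hs_mono.monotone (Nat.zero_le j)))
  rw [lintegral_const_mul _ (by fun_prop),
    lintegral_Ioi_poissonWeight m (mul_pos hp hr) hv, mul_assoc,
    ← tsum_ofReal_poissonWeight_mul_binCDF m (mul_nonneg hr.le hv) hp.le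
      (scale_ratio_le_one hs_pos hs_mono j), ← ENNReal.tsum_mul_left]
  refine tsum_congr fun n => ?_
  rw [Nat.add_sub_cancel]
  ring

end Coefficients

/-! ### Renewal epochs and the lifetime -/

section Renewal

/-- The law of the `n`-th renewal epoch for the interarrival law `ν`: the `n`-fold convolution
power of `ν`. -/
noncomputable def epochLaw (ν : Measure ℝ≥0∞) : ℕ → Measure ℝ≥0∞
  | 0 => Measure.dirac 0
  | n + 1 => Measure.conv ν (epochLaw ν n)

instance isProbabilityMeasure_epochLaw (ν : Measure ℝ≥0∞) [IsProbabilityMeasure ν] (n : ℕ) :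
    IsProbabilityMeasure (epochLaw ν n) := by
  induction n with
  | zero => exact Measure.dirac.isProbabilityMeasure
  | succ n ih => rw [epochLaw]; infer_instance

/-- The probability that an interarrival time of law `ν` carries a renewal epoch at `x` with
`x ≤ v` to a finite epoch above `v`. -/
noncomputable def jumpOver (ν : Measure ℝ≥0∞) (v x : ℝ≥0∞) : ℝ≥0∞ :=
  ν {y | x ≤ v ∧ v < x + y ∧ x + y < ∞}

theorem measurableSet_jumpOver (v : ℝ≥0∞) :
    MeasurableSet {p : ℝ≥0∞ × ℝ≥0∞ | p.1 ≤ v ∧ v < p.1 + p.2 ∧ p.1 + p.2 < ∞} :=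
  (measurableSet_le measurable_fst measurable_const).inter
    ((measurableSet_lt measurable_const measurable_add).inter
      (measurableSet_lt measurable_add measurable_const))

@[fun_prop]
theorem measurable_jumpOver (ν : Measure ℝ≥0∞) [SFinite ν] (v : ℝ≥0∞) :
    Measurable (jumpOver ν v) :=
  measurable_measure_prodMk_left (measurableSet_jumpOver v)

/-- Shifting the current epoch by `y` amounts to lowering the level by `y`. -/
theorem jumpOver_add {ν : Measure ℝ≥0∞} {v y : ℝ≥0∞} (hv : v ≠ ∞) (hy : y ≤ v) (x : ℝ≥0∞) :
    jumpOver ν v (y + x) = jumpOver ν (v - y) x := by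
  have hy' : y ≠ ∞ := ne_top_of_le_ne_top hv hy
  unfold jumpOver
  congr 1
  ext z
  simp only [Set.mem_ofPred_eq]
  rw [ENNReal.le_sub_iff_add_le_left hy' hy, add_assoc, ENNReal.add_lt_top,
    ENNReal.sub_lt_iff_lt_left hy' hy, and_iff_right (lt_top_iff_ne_top.2 hy')]

theorem jumpOver_of_lt {ν : Measure ℝ≥0∞} {v x : ℝ≥0∞} (h : v < x) : jumpOver ν v x = 0 := by
  simp [jumpOver, not_le.2 h]

theorem renewalEpoch_succ {Ω : Type*} (X : ℕ → Ω → ℝ≥0∞) (n : ℕ) (ω : Ω) :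
    renewalEpoch X (n + 1) ω = renewalEpoch X n ω + X n ω :=
  Finset.sum_range_succ _ _

theorem monotone_renewalEpoch {Ω : Type*} (X : ℕ → Ω → ℝ≥0∞) (ω : Ω) :
    Monotone fun n => renewalEpoch X n ω :=
  monotone_nat_of_le_succ fun n => by rw [renewalEpoch_succ]; exact le_self_add

variable {Ω : Type*} [MeasurableSpace Ω] {P : Measure Ω} {X : ℕ → Ω → ℝ≥0∞} {ν : Measure ℝ≥0∞}

theorem indepFun_renewalEpoch (hX : iIndepFun X P) (hlaw : ∀ n, HasLaw (X n) ν P) (n : ℕ) :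
    IndepFun (renewalEpoch X n) (X n) P := by
  have := hX.indepFun_sum_range_succ₀ (fun i => (hlaw i).aemeasurable) n
  have h : renewalEpoch X n = ∑ j ∈ Finset.range n, X j := by
    ext ω; simp [renewalEpoch]
  rwa [h]

theorem hasLaw_renewalEpoch [IsProbabilityMeasure P] [IsProbabilityMeasure ν]
    (hX : iIndepFun X P)
    (hlaw : ∀ n, HasLaw (X n) ν P) (n : ℕ) :
    HasLaw (renewalEpoch X n) (epochLaw ν n) P := by
  induction n with
  | zero =>
    have h : renewalEpoch X 0 = fun _ => 0 := by ext ω; simp [renewalEpoch]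
    rw [h, epochLaw]
    exact ⟨aemeasurable_const, by simp⟩
  | succ n ih =>
    have h : renewalEpoch X (n + 1) = renewalEpoch X n + X n := by
      ext ω; exact renewalEpoch_succ X n ω
    rw [h, epochLaw, Measure.conv_comm]
    exact (indepFun_renewalEpoch hX hlaw n).hasLaw_add ih (hlaw n)

/-- Measurability and probability of the event that the `(n + 1)`-st renewal epoch is finite and the
first one above `v`. The measurability holds up to null sets only, as the interarrival times are a.e. measurable. -/
theorem measure_crossing [IsProbabilityMeasure P] [IsProbabilityMeasure ν]
    (hX : iIndepFun X P)
    (hlaw : ∀ n, HasLaw (X n) ν P) (n : ℕ) (v : ℝ≥0∞) :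
    NullMeasurableSet {ω | renewalEpoch X n ω ≤ v ∧ v < renewalEpoch X (n + 1) ω ∧
      renewalEpoch X (n + 1) ω < ∞} P ∧
    P {ω | renewalEpoch X n ω ≤ v ∧ v < renewalEpoch X (n + 1) ω ∧
      renewalEpoch X (n + 1) ω < ∞} = ∫⁻ x, jumpOver ν v x ∂(epochLaw ν n) := by
  have hS := hasLaw_renewalEpoch hX hlaw n
  have hp : AEMeasurable (fun ω => (renewalEpoch X n ω, X n ω)) P :=
    hS.aemeasurable.prodMk (hlaw n).aemeasurable
  have hset : {ω | renewalEpoch X n ω ≤ v ∧ v < renewalEpoch X (n + 1) ω ∧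
      renewalEpoch X (n + 1) ω < ∞} = (fun ω => (renewalEpoch X n ω, X n ω)) ⁻¹'
        {p : ℝ≥0∞ × ℝ≥0∞ | p.1 ≤ v ∧ v < p.1 + p.2 ∧ p.1 + p.2 < ∞} := by
    ext ω; simp [renewalEpoch_succ]
  refine ⟨hset ▸ hp.nullMeasurableSet_preimage (measurableSet_jumpOver v), ?_⟩
  rw [hset, ← Measure.map_apply_of_aemeasurable hp (measurableSet_jumpOver v),
    (indepFun_iff_map_prod_eq_prod_map_map hS.aemeasurable (hlaw n).aemeasurable).1
      (indepFun_renewalEpoch hX hlaw n), hS.map_eq, (hlaw n).map_eq,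
    Measure.prod_apply (measurableSet_jumpOver v)]
  rfl

/-- The lifetime exceeds a finite level exactly when some finite renewal epoch is the first one
above it. -/
theorem setOf_lt_lifetime {Ω : Type*} (X : ℕ → Ω → ℝ≥0∞) (v : ℝ≥0∞) :
    {ω | v < lifetime X ω} = ⋃ n, {ω | renewalEpoch X n ω ≤ v ∧
      v < renewalEpoch X (n + 1) ω ∧ renewalEpoch X (n + 1) ω < ∞} := by
  ext ω
  simp only [Set.mem_ofPred_eq, Set.mem_iUnion, lifetime, lt_iSup_iff]
  constructor
  · intro h
    classical
    have hex : ∃ n, v < renewalEpoch X n ω := ⟨h.choose, h.choose_spec.choose_spec⟩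
    obtain ⟨k, hk_fin, hk⟩ := h
    have hfind := Nat.find_spec hex
    obtain ⟨m, hm⟩ : ∃ m, Nat.find hex = m + 1 := by
      refine Nat.exists_eq_succ_of_ne_zero fun h0 => ?_
      rw [h0] at hfind
      simp [renewalEpoch] at hfind
    refine ⟨m, not_lt.1 (Nat.find_min hex (by omega)), hm ▸ hfind, ?_⟩
    exact (monotone_renewalEpoch X ω (hm ▸ Nat.find_min' hex hk)).trans_lt hk_fin
  · rintro ⟨n, _, h2, h3⟩
    exact ⟨n + 1, h3, h2⟩

theorem measure_lt_lifetime [IsProbabilityMeasure P] [IsProbabilityMeasure ν]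
    (hX : iIndepFun X P)
    (hlaw : ∀ n, HasLaw (X n) ν P) (v : ℝ≥0∞) :
    P {ω | v < lifetime X ω} = ∑' n, ∫⁻ x, jumpOver ν v x ∂(epochLaw ν n) := by
  rw [setOf_lt_lifetime, measure_iUnion₀ _ fun n => (measure_crossing hX hlaw n v).1]
  · exact tsum_congr fun n => (measure_crossing hX hlaw n v).2
  · refine (pairwise_disjoint_on _ |>.2 fun i j hij => ?_).aedisjoint
    refine Set.disjoint_left.2 fun ω hi hj => ?_
    exact absurd (hi.2.1.trans_le (monotone_renewalEpoch X ω (Nat.succ_le_of_lt hij)))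
      (not_lt.2 hj.1)

end Renewal

/-! ### Coefficients of the lifetime tail -/

section Expansion

/-- The coefficients, in Poisson weights, of the probability that the `(n + 1)`-st renewal epoch is
the first one above a level; `B` and `C` are the coefficients of the interarrival density and
tail, and `ρ` is the mass of the interarrival law. -/
noncomputable def crossingCoeff (ρ : ℝ≥0∞) (B C : ℕ → ℝ≥0∞) : ℕ → ℕ → ℝ≥0∞
  | 0, k => ρ * C k
  | n + 1, k => ρ * ∑ i ∈ Finset.range k, B i * crossingCoeff ρ B C n (k - 1 - i)

/-- The Cauchy product with an index shift of one, at the level of coefficients with respect to an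
arbitrary sequence `q`. -/
theorem tsum_mul_tsum_shift (a b q : ℕ → ℝ≥0∞) :
    ∑' i, b i * ∑' l, a l * q (l + i + 1)
      = ∑' k, (∑ i ∈ Finset.range k, b i * a (k - 1 - i)) * q k := by
  have h1 : ∑' k, (∑ i ∈ Finset.range k, b i * a (k - 1 - i)) * q k
      = ∑' k, ∑ p ∈ Finset.HasAntidiagonal.antidiagonal k, b p.1 * (a p.2 * q (p.2 + p.1 + 1)) := by
    rw [tsum_eq_zero_add' ENNReal.summable]
    simp only [Finset.range_zero, Finset.sum_empty, zero_mul, zero_add, Nat.add_sub_cancel]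
    refine tsum_congr fun k => ?_
    rw [← Finset.Nat.sum_antidiagonal_eq_sum_range_succ (fun i l => b i * a l), Finset.sum_mul]
    refine Finset.sum_congr rfl fun p hp => ?_
    rw [add_comm p.2, Finset.HasAntidiagonal.mem_antidiagonal.1 hp, mul_assoc]
  have h2 : ∀ k, ∑ p ∈ Finset.HasAntidiagonal.antidiagonal k, b p.1 * (a p.2 * q (p.2 + p.1 + 1))
      = ∑' p : Finset.HasAntidiagonal.antidiagonal k,
        b (p : ℕ × ℕ).1 * (a (p : ℕ × ℕ).2 * q ((p : ℕ × ℕ).2 + (p : ℕ × ℕ).1 + 1)) := fun k =>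
    (Finset.tsum_subtype (Finset.HasAntidiagonal.antidiagonal k)
      (fun p : ℕ × ℕ => b p.1 * (a p.2 * q (p.2 + p.1 + 1)))).symm
  have h3 := Finset.HasAntidiagonal.sigmaAntidiagonalEquivProd.tsum_eq
    (fun p : ℕ × ℕ => b p.1 * (a p.2 * q (p.2 + p.1 + 1)))
  rw [ENNReal.tsum_sigma'] at h3
  rw [h1, tsum_congr h2]
  refine Eq.trans ?_ h3.symm
  rw [ENNReal.tsum_prod']
  simp_rw [ENNReal.tsum_mul_left]

/-- The recursion of `kappa` in a form that holds for all indices: where `kappa` is constant, the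
sum is empty because `mixB` vanishes, and `mixC` is `1`. -/
theorem kappa_eq {s w : ℕ → ℝ} (hw_sum : HasSum w 1) (ρ : ℝ) (m k : ℕ) :
    kappa ρ s w (m + 1) k = ρ * (mixC s w (m + 1) k +
      ∑ i ∈ Finset.range k, mixB s w (m + 1) i * kappa ρ s w (m + 1) (k - 1 - i)) := by
  rcases Nat.lt_or_ge m k with h | h
  · rw [kappa_of_ge _ _ _ _ _ (by omega) (by omega), add_comm]
    congr 2
    simp_rw [mul_comm (mixB s w (m + 1) _)]
    refine Finset.sum_subset (fun i hi => ?_) fun i hi hi' => ?_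
    · simp only [Finset.mem_Icc, Finset.mem_range] at hi ⊢; omega
    · simp only [Finset.mem_Icc, Finset.mem_range] at hi hi'
      rw [mixB_of_lt s w (by omega), mul_zero]
  · rw [kappa_of_le _ _ _ _ _ (by omega), mixC_of_le hw_sum (by omega),
      Finset.sum_eq_zero fun i hi => ?_, add_zero, mul_one]
    rw [mixB_of_lt s w (by simp only [Finset.mem_range] at hi; omega), zero_mul]

theorem kappa_nonneg {s w : ℕ → ℝ} (hs_pos : 0 < s 0) (hs_mono : StrictMono s)
    (hw : ∀ j, 0 ≤ w j) (hw_sum : HasSum w 1) {ρ : ℝ} (hρ : 0 ≤ ρ) (m k : ℕ) :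
    0 ≤ kappa ρ s w (m + 1) k := by
  induction k using Nat.strong_induction_on with
  | _ k ih =>
    rw [kappa_eq hw_sum]
    refine mul_nonneg hρ (add_nonneg (mixC_nonneg hs_pos hs_mono hw _ _)
      (Finset.sum_nonneg fun i hi => mul_nonneg (mixB_nonneg hs_pos hs_mono hw _ _) (ih _ ?_)))
    have := Finset.mem_range.1 hi
    omega

/-- Summing the crossing coefficients over the number of renewals turns their recursion into that
of `kappa`. -/
theorem tsum_crossingCoeff {s w : ℕ → ℝ} (hs_pos : 0 < s 0) (hs_mono : StrictMono s)
    (hw : ∀ j, 0 ≤ w j) (hw_sum : HasSum w 1) {ρ : ℝ} (hρ : 0 ≤ ρ) (m k : ℕ) :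
    ∑' n, crossingCoeff (ENNReal.ofReal ρ) (fun i => ENNReal.ofReal (mixB s w (m + 1) i))
        (fun i => ENNReal.ofReal (mixC s w (m + 1) i)) n k
      = ENNReal.ofReal (kappa ρ s w (m + 1) k) := by
  have hB := mixB_nonneg hs_pos hs_mono hw (m + 1)
  have hC := mixC_nonneg hs_pos hs_mono hw (m + 1)
  have hK := kappa_nonneg hs_pos hs_mono hw hw_sum hρ m
  induction k using Nat.strong_induction_on with
  | _ k ih =>
    rw [tsum_eq_zero_add' ENNReal.summable]
    simp only [crossingCoeff]
    rw [ENNReal.tsum_mul_left, Summable.tsum_finsetSum fun _ _ => ENNReal.summable, ← mul_add,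
      kappa_eq hw_sum, ENNReal.ofReal_mul hρ,
      ENNReal.ofReal_add (hC k) (Finset.sum_nonneg fun i _ => mul_nonneg (hB i) (hK _)),
      ENNReal.ofReal_sum_of_nonneg fun i _ => mul_nonneg (hB i) (hK _)]
    congr 2
    refine Finset.sum_congr rfl fun i hi => ?_
    have := Finset.mem_range.1 hi
    rw [ENNReal.tsum_mul_left, ih _ (by omega), ENNReal.ofReal_mul (hB i)]

variable {s w : ℕ → ℝ}

/-- The probability that the `(n + 1)`-st renewal epoch is the first one above `u`, expanded in
Poisson weights. -/
theorem lintegral_jumpOver_epochLaw (hs_pos : 0 < s 0) (hs_mono : StrictMono s)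
    (hw : ∀ j, 0 ≤ w j) (hw_sum : Summable w) (m : ℕ) {a : ℝ} (ha : 0 < a) (ρ : ℝ)
    {ν : Measure ℝ≥0∞} [IsProbabilityMeasure ν]
    (hν : ν = defectiveLaw ρ (mellinConv (discreteLaw s w) (erlangLaw (m + 1) a)))
    (n : ℕ) {u : ℝ} (hu : 0 ≤ u) :
    ∫⁻ x, jumpOver ν (ENNReal.ofReal u) x ∂(epochLaw ν n)
      = ∑' k, crossingCoeff (ENNReal.ofReal ρ)
          (fun i => ENNReal.ofReal (mixB s w (m + 1) i))
          (fun i => ENNReal.ofReal (mixC s w (m + 1) i)) n k *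
        ENNReal.ofReal (poissonWeight k (a / s 0 * u)) := by
  have hs : ∀ j, 0 < s j := fun j => hs_pos.trans_le (hs_mono.monotone (Nat.zero_le j))
  have hr : 0 < a / s 0 := div_pos ha hs_pos
  induction n generalizing u with
  | zero =>
    have hset : MeasurableSet {y : ℝ≥0∞ | ENNReal.ofReal u < y ∧ y < ∞} := measurableSet_Ioo
    rw [epochLaw, lintegral_dirac' _ (measurable_jumpOver ν _)]
    have h1 : jumpOver ν (ENNReal.ofReal u) 0
        = ∫⁻ y, {y : ℝ≥0∞ | ENNReal.ofReal u < y ∧ y < ∞}.indicator 1 y ∂ν := by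
      rw [lintegral_indicator_one hset]
      simp [jumpOver]
    rw [h1, hν, lintegral_defectiveLaw s w hs m ha ρ (measurable_one.indicator hset) (by simp)]
    simp_rw [crossingCoeff, mul_assoc]
    rw [ENNReal.tsum_mul_left,
      ← lintegral_Ioi_mixtureDensity hs_pos hs_mono hw hw_sum m hr hu]
    congr 1
    rw [← lintegral_indicator measurableSet_Ioi, ← lintegral_indicator measurableSet_Ioi]
    refine lintegral_congr fun y => ?_
    by_cases hy : u < y
    · have h0 : 0 < y := hu.trans_lt hy
      rw [Set.indicator_of_mem (by simpa using h0), Set.indicator_of_mem (s := Set.Ioi u) hy,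
        Set.indicator_of_mem, Pi.one_apply, one_mul]
      exact ⟨(ENNReal.ofReal_lt_ofReal_iff h0).2 hy, ENNReal.ofReal_lt_top⟩
    · rw [Set.indicator_of_notMem (s := Set.Ioi u) (by simpa using hy)]
      refine Set.indicator_apply_eq_zero.2 fun h0 => ?_
      rw [Set.indicator_of_notMem, zero_mul]
      exact fun h => hy ((ENNReal.ofReal_lt_ofReal_iff h0).1 h.1)
  | succ n ih =>
    set A := crossingCoeff (ENNReal.ofReal ρ) (fun i => ENNReal.ofReal (mixB s w (m + 1) i))
      (fun i => ENNReal.ofReal (mixC s w (m + 1) i)) with hA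
    have hmeas : Measurable fun y : ℝ≥0∞ =>
        ∫⁻ x, jumpOver ν (ENNReal.ofReal u) (y + x) ∂(epochLaw ν n) :=
      Measurable.lintegral_prod_right'
        (f := fun p : ℝ≥0∞ × ℝ≥0∞ => jumpOver ν (ENNReal.ofReal u) (p.1 + p.2)) (by fun_prop)
    have htop : ∫⁻ x, jumpOver ν (ENNReal.ofReal u) (∞ + x) ∂(epochLaw ν n) = 0 := by
      simp [jumpOver_of_lt]
    -- the first interarrival time `y` restarts the crossing problem at the level `u - y`
    have hstep : ∫⁻ y in Set.Ioi 0, (∫⁻ x, jumpOver ν (ENNReal.ofReal u)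
          (ENNReal.ofReal y + x) ∂(epochLaw ν n)) * mixtureDensity s w m (a / s 0) y
        = ∫⁻ y in Set.Ioc 0 u, ∑' i, ∑' k, ENNReal.ofReal (mixB s w (m + 1) i) *
          (A n k * (ENNReal.ofReal (poissonWeight k (a / s 0 * (u - y))) *
            ENNReal.ofReal (a / s 0 * poissonWeight i (a / s 0 * y)))) := by
      rw [← lintegral_indicator measurableSet_Ioi, ← lintegral_indicator measurableSet_Ioc]
      refine lintegral_congr fun y => ?_
      by_cases h0 : 0 < y
      · rw [Set.indicator_of_mem (by simpa using h0)]
        by_cases hy : y ≤ u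
        · rw [Set.indicator_of_mem (Set.mem_Ioc.2 ⟨h0, hy⟩)]
          simp_rw [jumpOver_add ENNReal.ofReal_ne_top (ENNReal.ofReal_le_ofReal hy),
            ← ENNReal.ofReal_sub u h0.le]
          rw [ih (sub_nonneg.2 hy),
            mixtureDensity_eq_tsum hs_pos hs_mono hw hw_sum m hr h0.le, mul_comm,
            ← ENNReal.tsum_mul_right]
          refine tsum_congr fun i => ?_
          rw [← ENNReal.tsum_mul_left]
          refine tsum_congr fun k => ?_
          ring
        · rw [Set.indicator_of_notMem fun h => hy h.2]
          have hlt : ENNReal.ofReal u < ENNReal.ofReal y :=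
            (ENNReal.ofReal_lt_ofReal_iff h0).2 (not_le.1 hy)
          simp [jumpOver_of_lt (hlt.trans_le le_self_add)]
      · rw [Set.indicator_of_notMem (by simpa using h0),
          Set.indicator_of_notMem fun h => h0 h.1]
    have hconv : ∫⁻ x, jumpOver ν (ENNReal.ofReal u) x ∂(epochLaw ν (n + 1))
        = ∫⁻ y, ∫⁻ x, jumpOver ν (ENNReal.ofReal u) (y + x) ∂(epochLaw ν n) ∂ν :=
      Measure.lintegral_conv (measurable_jumpOver ν _)
    have hlaw := lintegral_defectiveLaw s w hs m ha ρ hmeas htop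
    rw [← hν] at hlaw
    rw [hconv, hlaw, hstep, lintegral_tsum fun i => by fun_prop]
    have hterm : ∀ i, ∫⁻ y in Set.Ioc 0 u, ∑' k, ENNReal.ofReal (mixB s w (m + 1) i) *
          (A n k * (ENNReal.ofReal (poissonWeight k (a / s 0 * (u - y))) *
            ENNReal.ofReal (a / s 0 * poissonWeight i (a / s 0 * y))))
        = ENNReal.ofReal (mixB s w (m + 1) i) *
          ∑' k, A n k * ENNReal.ofReal (poissonWeight (k + i + 1) (a / s 0 * u)) := by
      intro i
      rw [lintegral_tsum fun k => by fun_prop, ← ENNReal.tsum_mul_left]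
      refine tsum_congr fun k => ?_
      rw [lintegral_const_mul _ (by fun_prop), lintegral_const_mul _ (by fun_prop),
        lintegral_Ioc_poissonWeight_mul k i hr hu]
    rw [tsum_congr hterm, tsum_mul_tsum_shift (A n) _
      (fun k => ENNReal.ofReal (poissonWeight k (a / s 0 * u))), ← ENNReal.tsum_mul_left]
    refine tsum_congr fun k => ?_
    rw [← mul_assoc]
    rfl

end Expansion

end ErlangizedScaleMixture

open ErlangizedScaleMixture in
theorem theorem3p4
    (s w : ℕ → ℝ) (hs_pos : 0 < s 0) (hs_mono : StrictMono s)
    (hw_nonneg : ∀ j, 0 ≤ w j) (hw_sum : HasSum w 1)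
    (ξ : ℕ) (hξ : 1 ≤ ξ)
    (ρ : ℝ) (hρ_nonneg : 0 ≤ ρ) (hρ_lt : ρ < 1)
    {Ω : Type*} [MeasurableSpace Ω] (P : Measure Ω) [IsProbabilityMeasure P]
    (X : ℕ → Ω → ℝ≥0∞)
    (hX : IsTerminatingRenewal P X ρ
      (mellinConv (discreteLaw s w) (erlangLaw ξ (ξ : ℝ)))) :
    (∀ i, Summable (mixBTerm s w ξ i)) ∧ (∀ n, Summable (mixCTerm s w ξ n)) ∧
    ∀ u : ℝ, 0 ≤ u →
      HasSum
        (fun n : ℕ => kappa ρ s w ξ n *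
          ((ξ * u / s 0) ^ n * Real.exp (-(ξ * u / s 0)) / (n.factorial : ℝ)))
        (lifetimeTail P X u) := by
  refine ⟨summable_mixBTerm hs_pos hs_mono hw_nonneg hw_sum.summable ξ,
    summable_mixCTerm hs_pos hs_mono hw_nonneg hw_sum.summable ξ, fun u hu => ?_⟩
  obtain ⟨m, rfl⟩ : ∃ m, ξ = m + 1 := ⟨ξ - 1, by omega⟩
  have hξ_pos : (0 : ℝ) < ((m + 1 : ℕ) : ℝ) := by positivity
  obtain ⟨ν, hν⟩ : ∃ ν, ν = defectiveLaw ρ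
    (mellinConv (discreteLaw s w) (erlangLaw (m + 1) ((m + 1 : ℕ) : ℝ))) := ⟨_, rfl⟩
  have hlaw : ∀ n, HasLaw (X n) ν P := fun n => hν ▸ hX.law n
  have hprob : IsProbabilityMeasure ν := by
    rw [← (hlaw 0).map_eq]
    exact Measure.isProbabilityMeasure_map (hlaw 0).aemeasurable
  have harg : ((m + 1 : ℕ) : ℝ) * u / s 0 = ((m + 1 : ℕ) : ℝ) / s 0 * u := by ring
  have hterm : ∀ n, 0 ≤ kappa ρ s w (m + 1) n *
      poissonWeight n (((m + 1 : ℕ) : ℝ) / s 0 * u) := fun n =>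
    mul_nonneg (kappa_nonneg hs_pos hs_mono hw_nonneg hw_sum hρ_nonneg m n)
      (poissonWeight_nonneg n (by positivity))
  have htsum : P {ω | ENNReal.ofReal u < lifetime X ω} = ∑' k, ENNReal.ofReal
      (kappa ρ s w (m + 1) k * poissonWeight k (((m + 1 : ℕ) : ℝ) / s 0 * u)) := by
    rw [measure_lt_lifetime hX.indep hlaw]
    simp_rw [lintegral_jumpOver_epochLaw hs_pos hs_mono hw_nonneg hw_sum.summable m hξ_pos ρ hν
      _ hu]
    rw [ENNReal.tsum_comm]
    refine tsum_congr fun k => ?_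
    rw [ENNReal.tsum_mul_right, tsum_crossingCoeff hs_pos hs_mono hw_nonneg hw_sum hρ_nonneg,
      ENNReal.ofReal_mul (kappa_nonneg hs_pos hs_mono hw_nonneg hw_sum hρ_nonneg m k)]
  have hsum : HasSum (fun k => (ENNReal.ofReal
      (kappa ρ s w (m + 1) k * poissonWeight k (((m + 1 : ℕ) : ℝ) / s 0 * u))).toReal)
      (lifetimeTail P X u) := by
    have hfin := htsum ▸ measure_ne_top P {ω | ENNReal.ofReal u < lifetime X ω}
    rw [lifetimeTail, measureReal_def, htsum,
      ENNReal.tsum_toReal_eq (ENNReal.ne_top_of_tsum_ne_top hfin)]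
    exact ENNReal.hasSum_toReal hfin
  simp_rw [ENNReal.toReal_ofReal (hterm _)] at hsum
  rw [harg]
  exact hsum
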